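/- Let $X$ be a complex Banach space. A linear relation $T\in LR(X)$ is a linear subspace of $X\times X$ (its graph; $y\in Tx$ means $(x,y)\in T$), and $T$ is closed if this subspace is closed. Write $N(T)=\{x : (x,0)\in T\}$, $R(T)=\{y : (x,y)\in T \text{ for some } x\}$, $T^{-1}=\{(y,x) : (x,y)\in T\}$ and, for $\lambda\in\mathbb C$, $\lambda-T=\{(x,\lambda x-y) : (x,y)\in T\}$. The resolvent of $T$ at $\lambda$ is the linear relation $T_\lambda=(\lambda-T)^{-1}$, and the resolvent set $\rho(T)$ consists of all $\lambda\in\mathbb C$ for which $T_\lambda$ is the graph of a single-valued, everywhere defined, bounded linear operator on $X$. Let $\alpha(T)=\dim N(T)$ and $\beta(T)=\dim X/R(T)$, with values in $\mathbb N\cup\{\infty\}$, and, if at least one of them is finite, $\kappa(T)=\alpha(T)-\beta(T)$. For a closed relation $T$ with closed range, $T\in\Phi_+$ if $\alpha(T)<\infty$, $T\in\Phi_-$ if $\beta(T)<\infty$, and $T\in\Phi$ if both are finite; relations that are not closed or have non-closed range belong to none of these classes. The essential resolvent sets are $$\rho_{e1}(T)=\{\lambda\in\mathbb C : \lambda-T\in\Phi_+\cup\Phi_-\},\quad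 \rho_{e2}(T)=\{\lambda\in\mathbb C : \lambda-T\in\Phi_+\},\quad \rho_{e3}(T)=\{\lambda\in\mathbb C : \lambda-T\in\Phi\},$$ $$\rho_{e4}(T)=\{\lambda\in\mathbb C : \lambda-T\in\Phi,\ \kappa(\lambda-T)=0\},$$ and $\rho_{e5}(T)$ is the union of those connected components of $\rho_{e1}(T)$ that meet $\rho(T)$. The essential spectra are $\sigma_{ei}(T)=\mathbb C\setminus\rho_{ei}(T)$, $i=1,\dots,5$. \textbf{Theorem.} Let $T\in LR(X)$ be closed and let $\mu\in\rho(T)$. Then for every $i\in\{1,2,3,4,5\}$ and every $\lambda\in\mathbb C$, $$\lambda\in\sigma_{ei}(T)\iff \lambda\neq\mu\ \text{ and }\ (\mu-\lambda)^{-1}\in\sigma_{ei}(T_\mu).$$ In particular, $\mu\notin\sigma_{ei}(T)$, and for $\lambda\ne\mu$ one has $\lambda\in\sigma_{ei}(T)$ if and only if $(\mu-\lambda)^{-1}\in\sigma_{ei}(T_\mu)$. -/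

import Mathlib

/-- A linear relation (multivalued linear operator) from `X` to `Y`, given by its graph:
`y ∈ T x` means `(x, y) ∈ T`. -/
abbrev LinearRelation (X Y : Type*) [AddCommGroup X] [Module ℂ X] [AddCommGroup Y] [Module ℂ Y] :
    Type _ :=
  Submodule ℂ (X × Y)

namespace LinearRelation

section Algebra

variable {X Y : Type*} [AddCommGroup X] [Module ℂ X] [AddCommGroup Y] [Module ℂ Y]

/-- The null space `N(T) = {x | 0 ∈ T x}`. -/
def nullSpace (T : LinearRelation X Y) : Submodule ℂ X :=
  T.comap (LinearMap.inl ℂ X Y)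

/-- The range `R(T) = {y | ∃ x, y ∈ T x}`. -/
def range (T : LinearRelation X Y) : Submodule ℂ Y :=
  T.map (LinearMap.snd ℂ X Y)

/-- The inverse relation `T⁻¹ = {(y, x) | (x, y) ∈ T}`. -/
def inverse (T : LinearRelation X Y) : LinearRelation Y X :=
  T.comap (LinearMap.prod (LinearMap.snd ℂ Y X) (LinearMap.fst ℂ Y X))

/-- The relation `z - T = {(x, z x - y) | (x, y) ∈ T}`. -/
def scalarSub (z : ℂ) (T : LinearRelation X X) : LinearRelation X X :=
  T.map (LinearMap.prod (LinearMap.fst ℂ X X) (z • LinearMap.fst ℂ X X - LinearMap.snd ℂ X X))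

/-- The resolvent `T_z = (z - T)⁻¹`, as a linear relation. -/
def resolventAt (T : LinearRelation X X) (z : ℂ) : LinearRelation X X :=
  (scalarSub z T).inverse

/-- The nullity `α(T) = dim N(T)`, in `ℕ ∪ {∞}`. -/
noncomputable def nullity (T : LinearRelation X Y) : ℕ∞ :=
  Cardinal.toENat (Module.rank ℂ T.nullSpace)

/-- The deficiency `β(T) = dim Y / R(T)`, in `ℕ ∪ {∞}`. -/
noncomputable def deficiency (T : LinearRelation X Y) : ℕ∞ :=
  Cardinal.toENat (Module.rank ℂ (Y ⧸ T.range))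

/-- The index `κ(T) = α(T) - β(T)`, an integer or `±∞`. It is meaningful when at least one of
`α(T)`, `β(T)` is finite. -/
noncomputable def index (T : LinearRelation X Y) : EReal :=
  ((T.nullity : ENNReal) : EReal) - ((T.deficiency : ENNReal) : EReal)

theorem mem_nullSpace {T : LinearRelation X Y} {x : X} : x ∈ T.nullSpace ↔ (x, (0 : Y)) ∈ T :=
  Iff.rfl

theorem mem_range {T : LinearRelation X Y} {y : Y} : y ∈ T.range ↔ ∃ x, (x, y) ∈ T := by
  simp [range]

theorem mem_inverse {T : LinearRelation X Y} {x : X} {y : Y} :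
    (y, x) ∈ T.inverse ↔ (x, y) ∈ T :=
  Iff.rfl

theorem mem_scalarSub {z : ℂ} {T : LinearRelation X X} {x w : X} :
    (x, w) ∈ scalarSub z T ↔ ∃ y, (x, y) ∈ T ∧ w = z • x - y := by
  simp only [scalarSub, Submodule.mem_map, Prod.exists, LinearMap.prod_apply, Function.prod,
    LinearMap.fst_apply, LinearMap.sub_apply, LinearMap.smul_apply, LinearMap.snd_apply,
    Prod.mk.injEq]
  constructor
  · rintro ⟨a, b, h, rfl, rfl⟩
    exact ⟨b, h, rfl⟩
  · rintro ⟨y, h, rfl⟩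
    exact ⟨x, y, h, rfl, rfl⟩

end Algebra

section Analysis

variable {X Y : Type*} [NormedAddCommGroup X] [NormedSpace ℂ X]
  [NormedAddCommGroup Y] [NormedSpace ℂ Y]

/-- `T` is a closed relation: its graph is closed in `X × Y`. -/
def IsClosedRel (T : LinearRelation X Y) : Prop :=
  IsClosed (T : Set (X × Y))

/-- The class `Φ₊` of upper semi-Fredholm relations. -/
def IsUpperSemiFredholm (T : LinearRelation X Y) : Prop :=
  T.IsClosedRel ∧ IsClosed (T.range : Set Y) ∧ T.nullity < ⊤

/-- The class `Φ₋` of lower semi-Fredholm relations. -/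
def IsLowerSemiFredholm (T : LinearRelation X Y) : Prop :=
  T.IsClosedRel ∧ IsClosed (T.range : Set Y) ∧ T.deficiency < ⊤

/-- The class `Φ` of Fredholm relations. -/
def IsFredholm (T : LinearRelation X Y) : Prop :=
  T.IsClosedRel ∧ IsClosed (T.range : Set Y) ∧ T.nullity < ⊤ ∧ T.deficiency < ⊤

/-- The resolvent set `ρ(T)`: all `z` for which `(z - T)⁻¹` is (the graph of) a single-valued,
everywhere defined, bounded linear operator. -/
def resolventSet (T : LinearRelation X X) : Set ℂ :=
  {z | ∃ R : X →L[ℂ] X, T.resolventAt z = LinearMap.graph (R : X →ₗ[ℂ] X)}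

/-- `ρ_{e1}(T)`. -/
def essResolvent1 (T : LinearRelation X X) : Set ℂ :=
  {z | (scalarSub z T).IsUpperSemiFredholm ∨ (scalarSub z T).IsLowerSemiFredholm}

/-- `ρ_{e2}(T)`. -/
def essResolvent2 (T : LinearRelation X X) : Set ℂ :=
  {z | (scalarSub z T).IsUpperSemiFredholm}

/-- `ρ_{e3}(T)`. -/
def essResolvent3 (T : LinearRelation X X) : Set ℂ :=
  {z | (scalarSub z T).IsFredholm}

/-- `ρ_{e4}(T)`. -/
def essResolvent4 (T : LinearRelation X X) : Set ℂ :=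
  {z | (scalarSub z T).IsFredholm ∧ (scalarSub z T).index = 0}

/-- `ρ_{e5}(T)`: the union of the connected components of `ρ_{e1}(T)` that meet `ρ(T)`. -/
def essResolvent5 (T : LinearRelation X X) : Set ℂ :=
  ⋃₀ {C | (∃ z ∈ T.essResolvent1, C = connectedComponentIn T.essResolvent1 z) ∧
    (C ∩ T.resolventSet).Nonempty}

/-- The five essential resolvent sets; `i : Fin 5` takes the values `0, …, 4`, and the value `i`
stands for `ρ_{e(i+1)}(T)`. -/
def essResolvent (T : LinearRelation X X) (i : Fin 5) : Set ℂ :=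
  match i with
  | 0 => T.essResolvent1
  | 1 => T.essResolvent2
  | 2 => T.essResolvent3
  | 3 => T.essResolvent4
  | 4 => T.essResolvent5

/-- The essential spectra `σ_{e(i+1)}(T) = ℂ \ ρ_{e(i+1)}(T)`. -/
def essSpectrum (T : LinearRelation X X) (i : Fin 5) : Set ℂ :=
  (T.essResolvent i)ᶜ

end Analysis

end LinearRelation

/-! For `z ≠ μ` put `w = (μ - z)⁻¹`. Rescaling graph elements shows that `w - T_μ` and `z - T` have
the same null space and the same range. Both relations are closed, so nullity, deficiency, index and
closedness of the range agree, which settles `ρ_{e1}`, …, `ρ_{e4}` away from `μ`. At `μ` itself,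
`ρ(T)` lies in every essential resolvent set.

For `ρ_{e5}`, the map `z ↦ (μ - z)⁻¹` is a homeomorphism of `ℂ \ {μ}` onto `ℂ \ {0}` that respects
`ρ_{e1}` and `ρ`, but components may pass through the deleted points. Deleting an interior point
does not disconnect a planar connected set (`IsPreconnected.exists_notMem`). The point `μ` is
interior because `ρ(T)` is open; for `0` one needs `ρ_{e1}(T_μ)` open, which is the stability of
semi-Fredholm bounded operators. -/

open Filter Topology

/-! ### Perturbation of semi-Fredholm bounded operators -/

namespace ContinuousLinearMap

variable {𝕜 E F : Type*} [RCLike 𝕜] [NormedAddCommGroup E] [NormedSpace 𝕜 E] [CompleteSpace E]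
  [NormedAddCommGroup F] [NormedSpace 𝕜 F] [CompleteSpace F]

/-- A bounded operator between Banach spaces whose range has finite codimension has closed
range. -/
theorem isClosed_range_of_finiteDimensional_quotient_range (A : E →L[𝕜] F)
    [FiniteDimensional 𝕜 (F ⧸ A.range)] : IsClosed (A.range : Set F) := by
  obtain ⟨G, hG⟩ := Submodule.exists_isCompl A.range
  have : FiniteDimensional 𝕜 G :=
    (Submodule.quotientEquivOfIsCompl _ _ hG).finiteDimensional
  have hker : IsClosed (A.ker : Set E) := A.isClosed_ker
  -- Dividing out the kernel makes the operator injective without changing its range.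
  let g : (E ⧸ A.ker) →L[𝕜] F := A.ker.liftQL A le_rfl
  have hg : g.range = A.range := by
    ext y
    simp only [LinearMap.mem_range]
    constructor
    · rintro ⟨x, rfl⟩
      obtain ⟨x, rfl⟩ := Submodule.mkQ_surjective _ x
      exact ⟨x, rfl⟩
    · rintro ⟨x, rfl⟩
      exact ⟨A.ker.mkQ x, rfl⟩
  have hk : g.ker = ⊥ := by
    rw [LinearMap.ker_eq_bot']
    intro x hx
    obtain ⟨x, rfl⟩ := Submodule.mkQ_surjective _ x
    exact (Submodule.Quotient.mk_eq_zero _).2 hx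
  have := g.closed_complemented_range_of_isCompl_of_ker_eq_bot G (hg ▸ hG)
    G.closed_of_finiteDimensional hk
  rwa [hg] at this

/-- Closed range and finite-dimensional kernel are together stable under small perturbations. -/
theorem eventually_isClosed_range_and_finiteDimensional_ker (A : E →L[𝕜] F)
    (hA : IsClosed (A.range : Set F)) [FiniteDimensional 𝕜 A.ker] :
    ∀ᶠ B : E →L[𝕜] F in 𝓝 A, IsClosed (B.range : Set F) ∧ FiniteDimensional 𝕜 B.ker := by
  obtain ⟨M, hMc, hM⟩ :=
    (Submodule.ClosedComplemented.of_finiteDimensional A.ker).exists_isClosed_isCompl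
  have : CompleteSpace M := hMc.completeSpace_coe
  have hfdM : FiniteDimensional 𝕜 (E ⧸ M) :=
    (Submodule.quotientEquivOfIsCompl _ _ hM.symm).symm.finiteDimensional
  let g : M →L[𝕜] F := A.comp M.subtypeL
  have hg : Function.Injective g := by
    rw [injective_iff_map_eq_zero]
    rintro ⟨x, hx⟩ h
    exact Subtype.ext (Submodule.disjoint_def.1 hM.disjoint x h hx)
  have hgr : Set.range g = (A.range : Set F) := by
    ext y
    constructor
    · rintro ⟨x, rfl⟩
      exact ⟨x, rfl⟩
    · rintro ⟨x, rfl⟩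
      obtain ⟨n, hn, m, hm, rfl⟩ := Submodule.mem_sup.1 (hM.sup_eq_top ▸ Submodule.mem_top : x ∈ _)
      have hn' : A n = 0 := hn
      exact ⟨⟨m, hm⟩, by simp [g, hn']⟩
  obtain ⟨K, hK⟩ := g.antilipschitz_of_injective_of_isClosed_range hg (hgr ▸ hA)
  have hsmall : ∀ᶠ B : E →L[𝕜] F in 𝓝 A, K * ‖B - A‖ < 1 / 2 := by
    have : Tendsto (fun B : E →L[𝕜] F => (K : ℝ) * ‖B - A‖) (𝓝 A) (𝓝 (K * ‖A - A‖)) :=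
      Continuous.tendsto (by fun_prop) A
    exact this.eventually_lt_const (by simp)
  filter_upwards [hsmall] with B hB
  -- `A` is bounded below on `M` with constant `K`; the error `K‖B - A‖‖m‖ ≤ ‖m‖/2` is absorbed on
  -- the left, hence `2K`.
  have hbound : ∀ m ∈ M, ‖m‖ ≤ 2 * K * ‖B m‖ := by
    intro m hm
    have h1 : ‖m‖ ≤ K * ‖A m‖ := ZeroHomClass.bound_of_antilipschitz g hK ⟨m, hm⟩
    have h2 : ‖A m‖ ≤ ‖B m‖ + ‖B - A‖ * ‖m‖ := by
      calc ‖A m‖ = ‖B m - (B - A) m‖ := by simp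
        _ ≤ ‖B m‖ + ‖(B - A) m‖ := norm_sub_le _ _
        _ ≤ _ := by gcongr; exact (B - A).le_opNorm m
    have h3 : (K : ℝ) * ‖A m‖ ≤ K * (‖B m‖ + ‖B - A‖ * ‖m‖) := by gcongr
    nlinarith [norm_nonneg m, mul_le_mul_of_nonneg_right hB.le (norm_nonneg m)]
  constructor
  · have hanti : AntilipschitzWith (2 * K) (B.comp M.subtypeL) :=
      (B.comp M.subtypeL).antilipschitz_of_bound fun m => by simpa using hbound m m.2
    have hcl : IsClosed (M.map (B : E →ₗ[𝕜] F) : Set F) := by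
      convert hanti.isClosed_range (B.comp M.subtypeL).uniformContinuous using 1
      ext y
      simp
    have : M.CoFG := hfdM
    exact LinearMap.isClosed_range_of_isClosed_map_of_finiteDimensional_quotient hcl
  -- `B` is injective on `M`, so its kernel embeds in the finite-dimensional `E ⧸ M`.
  · refine FiniteDimensional.of_injective (M.mkQ ∘ₗ B.ker.subtype) ?_
    rw [injective_iff_map_eq_zero]
    rintro ⟨x, hx⟩ h
    have hxM : x ∈ M := (Submodule.Quotient.mk_eq_zero _).1 h
    have hx0 : B x = 0 := hx
    have := hbound x hxM
    rw [hx0, norm_zero, mul_zero] at this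
    exact Subtype.ext (norm_le_zero_iff.1 this)

/-- Surjectivity is stable under small perturbations. -/
theorem eventually_range_eq_top (A : E →L[𝕜] F) (hA : A.range = ⊤) :
    ∀ᶠ B : E →L[𝕜] F in 𝓝 A, B.range = ⊤ := by
  let s := A.nonlinearRightInverseOfSurjective hA
  have hs : 0 < s.nnnorm := A.nonlinearRightInverseOfSurjective_nnnorm_pos hA
  have hsmall : ∀ᶠ B : E →L[𝕜] F in 𝓝 A, ‖B - A‖₊ < s.nnnorm⁻¹ := by
    have : Tendsto (fun B : E →L[𝕜] F => ‖B - A‖₊) (𝓝 A) (𝓝 ‖A - A‖₊) :=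
      Continuous.tendsto (by fun_prop) A
    exact this.eventually_lt_const (by simpa using hs)
  filter_upwards [hsmall] with B hB
  have happ : ApproximatesLinearOn B A Set.univ ‖B - A‖₊ := fun x _ y _ => by
    rw [← map_sub, ← sub_apply]
    exact (B - A).le_opNorm _
  rw [eq_top_iff]
  intro y _
  have hpos : 0 < (s.nnnorm : ℝ)⁻¹ - ‖B - A‖₊ := sub_pos.2 (by exact_mod_cast hB)
  -- The radius is chosen so that the image covers the closed ball of radius `‖y‖` about `B 0 = 0`.
  obtain ⟨x, -, hx⟩ := happ.surjOn_closedBall_of_nonlinearRightInverse s (b := 0)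
    (ε := ‖y‖ / ((s.nnnorm : ℝ)⁻¹ - ‖B - A‖₊)) (by positivity) (Set.subset_univ _)
    (show y ∈ _ by rw [mul_div_cancel₀ _ hpos.ne']; simp)
  exact ⟨x, hx⟩

/-- Finite codimension of the range is stable under small perturbations. -/
theorem eventually_finiteDimensional_quotient_range (A : E →L[𝕜] F)
    [FiniteDimensional 𝕜 (F ⧸ A.range)] :
    ∀ᶠ B : E →L[𝕜] F in 𝓝 A, FiniteDimensional 𝕜 (F ⧸ B.range) := by
  obtain ⟨G, hG⟩ := Submodule.exists_isCompl A.range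
  have : FiniteDimensional 𝕜 G :=
    (Submodule.quotientEquivOfIsCompl _ _ hG).finiteDimensional
  have : CompleteSpace G := FiniteDimensional.complete 𝕜 G
  -- Adjoining the finite-dimensional complement `G` reduces the claim to stability of surjectivity.
  have hrange : ∀ B : E →L[𝕜] F, (B.coprod G.subtypeL).range = B.range ⊔ G := fun B => by
    simp [LinearMap.range_coprod]
  have hcont : Continuous fun B : E →L[𝕜] F => B.coprod G.subtypeL := by
    have : (fun B : E →L[𝕜] F => B.coprod G.subtypeL) =
        fun B => B.comp (fst 𝕜 E G) + G.subtypeL.comp (snd 𝕜 E G) := by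
      ext <;> simp
    rw [this]
    fun_prop
  filter_upwards [hcont.continuousAt.eventually
    ((A.coprod G.subtypeL).eventually_range_eq_top (by rw [hrange, hG.sup_eq_top]))] with B hB
  rw [hrange] at hB
  refine FiniteDimensional.of_surjective (B.range.mkQ ∘ₗ G.subtype) fun y => ?_
  obtain ⟨y, rfl⟩ := Submodule.mkQ_surjective _ y
  obtain ⟨b, hb, c, hc, rfl⟩ := Submodule.mem_sup.1 (hB ▸ Submodule.mem_top : y ∈ _)
  refine ⟨⟨c, hc⟩, ?_⟩
  rw [map_add, (LinearMap.mem_ker.1 (by rwa [Submodule.ker_mkQ]) : B.range.mkQ b = 0), zero_add]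
  rfl

end ContinuousLinearMap

/-! ### Null space and range of the resolvent -/

namespace LinearRelation

section Algebra

variable {X : Type*} [AddCommGroup X] [Module ℂ X] {T : LinearRelation X X}

theorem mem_scalarSub_iff {z : ℂ} {x w : X} : (x, w) ∈ scalarSub z T ↔ (x, z • x - w) ∈ T := by
  rw [mem_scalarSub]
  constructor
  · rintro ⟨y, h, rfl⟩
    simpa using h
  · intro h
    exact ⟨_, h, by simp⟩

theorem mem_resolventAt_iff {z : ℂ} {x w : X} : (w, x) ∈ T.resolventAt z ↔ (x, z • x - w) ∈ T :=
  mem_scalarSub_iff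

theorem smul_mem_iff {c : ℂ} (hc : c ≠ 0) {x y : X} : (c • x, c • y) ∈ T ↔ (x, y) ∈ T :=
  Submodule.smul_mem_iff T (x := (x, y)) hc

variable (T) in
theorem nullSpace_scalarSub_resolventAt {μ z : ℂ} (hz : z ≠ μ) :
    (scalarSub (μ - z)⁻¹ (T.resolventAt μ)).nullSpace = (scalarSub z T).nullSpace := by
  have h : μ - z ≠ 0 := sub_ne_zero.2 hz.symm
  ext x
  rw [mem_nullSpace, mem_nullSpace, mem_scalarSub_iff, mem_scalarSub_iff, mem_resolventAt_iff,
    ← smul_mem_iff (inv_ne_zero h) (y := z • x - 0)]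
  have : μ • ((μ - z)⁻¹ • x - 0) - x = (μ - z)⁻¹ • (z • x - 0) := by
    match_scalars
    field_simp
    ring
  rw [this, sub_zero]

variable (T) in
theorem range_scalarSub_resolventAt {μ z : ℂ} (hz : z ≠ μ) :
    (scalarSub (μ - z)⁻¹ (T.resolventAt μ)).range = (scalarSub z T).range := by
  have h : μ - z ≠ 0 := sub_ne_zero.2 hz.symm
  ext y
  simp only [mem_range, mem_scalarSub_iff, mem_resolventAt_iff]
  constructor
  · rintro ⟨u, hu⟩
    -- This is the first coordinate of `hu` scaled by `(μ - z)⁻¹`; the converse solves the same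
    -- relation for `u`.
    refine ⟨(μ - z)⁻¹ • ((μ - z)⁻¹ • u - y), ?_⟩
    rw [← smul_mem_iff (inv_ne_zero h)] at hu
    convert hu using 2
    match_scalars <;> field_simp <;> ring
  · rintro ⟨x, hx⟩
    refine ⟨(μ - z) • ((μ - z) • x + y), ?_⟩
    rw [← smul_mem_iff h] at hx
    convert hx using 2
    · match_scalars <;> field_simp
      ring
    · match_scalars <;> field_simp <;> ring

end Algebra
end LinearRelation

/-! ### Deleting a point from a planar connected set -/

/-- The punctured disc is the image of the convex half-plane `re w < log r` under `w ↦ p + exp w`.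
-/
theorem Complex.isPreconnected_ball_diff_singleton (p : ℂ) (r : ℝ) :
    IsPreconnected (Metric.ball p r \ {p}) := by
  rcases le_or_gt r 0 with hr | hr
  · simp [Metric.ball_eq_empty.2 hr, isPreconnected_empty]
  have : Metric.ball p r \ {p} = (fun w => p + Complex.exp w) '' {w | w.re < Real.log r} := by
    ext x
    simp only [Set.mem_sdiff, Metric.mem_ball, Set.mem_singleton_iff, Set.mem_image,
      Set.mem_ofPred_eq]
    constructor
    · rintro ⟨hx, hxp⟩
      refine ⟨Complex.log (x - p), ?_, ?_⟩
      · rw [Complex.log_re]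
        exact Real.log_lt_log (norm_pos_iff.2 (sub_ne_zero.2 hxp)) (by rwa [← dist_eq_norm])
      · rw [Complex.exp_log (sub_ne_zero.2 hxp)]
        ring
    · rintro ⟨w, hw, rfl⟩
      refine ⟨?_, by simp⟩
      rw [dist_eq_norm, add_sub_cancel_left, Complex.norm_exp]
      exact (Real.lt_log_iff_exp_lt hr).1 hw
  rw [this]
  exact (convex_halfSpace_re_lt _).isPreconnected.image _ (by fun_prop)

/-- A preconnected set containing a disc around `p` stays preconnected when `p` is removed. -/
theorem IsPreconnected.diff_singleton_of_ball_subset {C : Set ℂ} (hC : IsPreconnected C) {p : ℂ}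
    {r : ℝ} (hr : 0 < r) (hB : Metric.ball p r ⊆ C) : IsPreconnected (C \ {p}) := by
  have key : ∀ u v : Set ℂ, IsOpen u → IsOpen v → C \ {p} ⊆ u ∪ v → C \ {p} ∩ (u ∩ v) = ∅ →
      Metric.ball p r \ {p} ⊆ u → C \ {p} ⊆ u := by
    intro u v hu hv huv hd hBu
    -- Giving `p` back to the side that contains the punctured disc turns a separation of `C \ {p}`
    -- into one of `C`.
    have h := isPreconnected_iff_subset_of_disjoint.1 hC (u ∪ Metric.ball p r) (v \ {p})
      (hu.union Metric.isOpen_ball) (hv.sdiff isClosed_singleton) ?_ ?_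
    · rcases h with h | h
      · rintro x ⟨hx, hxp⟩
        exact (h hx).elim id fun hxB => hBu ⟨hxB, hxp⟩
      · exact absurd rfl (h (hB (Metric.mem_ball_self hr))).2
    · intro x hx
      by_cases hxp : x = p
      · exact Or.inl (Or.inr (hxp ▸ Metric.mem_ball_self hr))
      · exact (huv ⟨hx, hxp⟩).imp Or.inl fun h => ⟨h, hxp⟩
    · rw [Set.eq_empty_iff_forall_notMem] at hd ⊢
      rintro x ⟨hx, hxu, hxv, hxp⟩
      exact hd x ⟨⟨hx, hxp⟩, hxu.elim id fun hxB => hBu ⟨hxB, hxp⟩, hxv⟩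
  rw [isPreconnected_iff_subset_of_disjoint]
  intro u v hu hv huv hd
  have hsub : Metric.ball p r \ {p} ⊆ C \ {p} := Set.sdiff_subset_sdiff_left hB
  rcases isPreconnected_iff_subset_of_disjoint.1 (Complex.isPreconnected_ball_diff_singleton p r)
    u v hu hv (hsub.trans huv)
    (Set.subset_eq_empty (Set.inter_subset_inter_left _ hsub) hd) with h | h
  · exact Or.inl (key u v hu hv huv hd h)
  · exact Or.inr (key v u hv hu (Set.union_comm u v ▸ huv) (Set.inter_comm u v ▸ hd) h)

/-- A connection inside `S` from `z` to an open set `U` can be made to avoid a point `p ≠ z`,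
provided `S` is a neighbourhood of `p` if it contains `p`. -/
theorem IsPreconnected.exists_notMem {S U C : Set ℂ} {p z : ℂ} (hC : IsPreconnected C)
    (hCS : C ⊆ S) (hS : p ∈ S → S ∈ 𝓝 p) (hU : IsOpen U) (hz : z ∈ C) (hzp : z ≠ p)
    (hCU : (C ∩ U).Nonempty) :
    ∃ D ⊆ S, IsPreconnected D ∧ z ∈ D ∧ p ∉ D ∧ (D ∩ U).Nonempty := by
  by_cases hp : p ∈ C
  · obtain ⟨r, hr, hB⟩ := Metric.mem_nhds_iff.1 (hS (hCS hp))
    refine ⟨(C ∪ Metric.ball p r) \ {p}, Set.sdiff_subset.trans (Set.union_subset hCS hB),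
      (hC.union p hp (Metric.mem_ball_self hr)
        (convex_ball p r).isPreconnected).diff_singleton_of_ball_subset hr Set.subset_union_right,
      ⟨Or.inl hz, hzp⟩, by simp, ?_⟩
    obtain ⟨q, hqC, hqU⟩ := hCU
    by_cases hq : q = p
    · subst hq
      -- The known point of `C ∩ U` is the deleted one; a nearby point of the open set `U` replaces
      -- it.
      have hnear : ∀ᶠ x in 𝓝[≠] q, x ∈ U ∩ Metric.ball q r :=
        nhdsWithin_le_nhds (inter_mem (hU.mem_nhds hqU) (Metric.ball_mem_nhds q hr))
      obtain ⟨x, ⟨hxU, hxB⟩, hx⟩ := (hnear.and self_mem_nhdsWithin).exists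
      exact ⟨x, ⟨Or.inr hxB, hx⟩, hxU⟩
    · exact ⟨q, ⟨Or.inl hqC, hq⟩, hqU⟩
  · exact ⟨C, hCS, hC, hz, hp, hCU⟩

/-! ### Closed relations and the closed graph theorem -/

namespace LinearRelation

section Fredholm

variable {X Y : Type*} [NormedAddCommGroup X] [NormedSpace ℂ X]
  [NormedAddCommGroup Y] [NormedSpace ℂ Y]

theorem nullity_lt_top_iff {T : LinearRelation X Y} :
    T.nullity < ⊤ ↔ FiniteDimensional ℂ T.nullSpace := by
  rw [nullity, Cardinal.toENat_lt_top, Module.rank_lt_aleph0_iff]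

theorem deficiency_lt_top_iff {T : LinearRelation X Y} :
    T.deficiency < ⊤ ↔ FiniteDimensional ℂ (Y ⧸ T.range) := by
  rw [deficiency, Cardinal.toENat_lt_top, Module.rank_lt_aleph0_iff]

theorem nullSpace_graph (A : X →ₗ[ℂ] Y) : nullSpace A.graph = LinearMap.ker A := by
  ext x
  simp [mem_nullSpace, LinearMap.mem_graph_iff, eq_comm]

theorem range_graph (A : X →ₗ[ℂ] Y) : range A.graph = LinearMap.range A := by
  ext y
  simp [mem_range, LinearMap.mem_graph_iff, eq_comm]

theorem isClosedRel_graph (A : X →L[ℂ] Y) :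
    IsClosedRel (LinearMap.graph (A : X →ₗ[ℂ] Y)) := by
  have : ((LinearMap.graph (A : X →ₗ[ℂ] Y) : Submodule ℂ (X × Y)) : Set (X × Y)) =
      {p | p.2 = A p.1} := by
    ext p
    simp [LinearMap.mem_graph_iff]
  rw [IsClosedRel, this]
  exact isClosed_eq continuous_snd (by fun_prop)

theorem IsClosedRel.inverse {T : LinearRelation X Y} (hT : T.IsClosedRel) :
    T.inverse.IsClosedRel :=
  hT.preimage continuous_swap

theorem IsClosedRel.scalarSub {T : LinearRelation X X} (hT : T.IsClosedRel) (z : ℂ) :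
    (scalarSub z T).IsClosedRel := by
  have : (LinearRelation.scalarSub z T : Set (X × X)) =
      (fun p : X × X => (p.1, z • p.1 - p.2)) ⁻¹' T := by
    ext ⟨x, w⟩
    exact mem_scalarSub_iff
  rw [IsClosedRel, this]
  exact IsClosed.preimage (by fun_prop) hT

theorem IsClosedRel.resolventAt {T : LinearRelation X X} (hT : T.IsClosedRel) (z : ℂ) :
    (T.resolventAt z).IsClosedRel :=
  (hT.scalarSub z).inverse

/-- A closed relation between Banach spaces that is injective and surjective has a bounded
single-valued inverse, and conversely. -/
theorem IsClosedRel.exists_inverse_eq_graph_iff [CompleteSpace X] [CompleteSpace Y]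
    {T : LinearRelation X Y} (hT : T.IsClosedRel) :
    (∃ R : Y →L[ℂ] X, T.inverse = LinearMap.graph (R : Y →ₗ[ℂ] X)) ↔
      T.nullSpace = ⊥ ∧ T.range = ⊤ := by
  constructor
  · rintro ⟨R, hR⟩
    have hmem : ∀ x y, (x, y) ∈ T ↔ x = R y := fun x y => by
      rw [← mem_inverse, hR, LinearMap.mem_graph_iff]
      rfl
    refine ⟨?_, ?_⟩
    · ext x
      simp [mem_nullSpace, hmem]
    · ext y
      simp [mem_range, hmem]
  · rintro ⟨hN, hR⟩
    let p : T.inverse →ₗ[ℂ] Y := LinearMap.fst ℂ Y X ∘ₗ T.inverse.subtype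
    have hp : Function.Bijective p := by
      constructor
      · rw [injective_iff_map_eq_zero]
        rintro ⟨⟨y, x⟩, h⟩ (rfl : y = 0)
        have : x ∈ T.nullSpace := h
        rw [hN, Submodule.mem_bot] at this
        simp [this]
      · intro y
        obtain ⟨x, hx⟩ := mem_range.1 (hR ▸ Submodule.mem_top : y ∈ T.range)
        exact ⟨⟨(y, x), hx⟩, rfl⟩
    let e := LinearEquiv.ofBijective p hp
    let g : Y →ₗ[ℂ] X := LinearMap.snd ℂ Y X ∘ₗ T.inverse.subtype ∘ₗ e.symm.toLinearMap
    have hg : T.inverse = g.graph := by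
      ext ⟨y, x⟩
      rw [LinearMap.mem_graph_iff]
      constructor
      · intro h
        have : e.symm y = ⟨(y, x), h⟩ := (LinearEquiv.symm_apply_eq e).2 rfl
        simp [g, this]
      · rintro (rfl : x = g y)
        have h : e (e.symm y) = y := e.apply_symm_apply y
        have : (y, g y) = (e.symm y : Y × X) := Prod.ext h.symm rfl
        rw [this]
        exact (e.symm y).2
    have hcl : IsClosed (g.graph : Set (Y × X)) := hg ▸ hT.inverse
    exact ⟨ContinuousLinearMap.ofIsClosedGraph hcl, hg⟩

end Fredholm

/-! ### Resolvent set and essential resolvent sets -/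

section Spectrum

variable {X : Type*} [NormedAddCommGroup X] [NormedSpace ℂ X] {T : LinearRelation X X}

theorem mem_resolventSet_iff [CompleteSpace X] (hT : T.IsClosedRel) {z : ℂ} :
    z ∈ T.resolventSet ↔ (scalarSub z T).nullSpace = ⊥ ∧ (scalarSub z T).range = ⊤ :=
  (hT.scalarSub z).exists_inverse_eq_graph_iff

/-- With `R = T_μ`, formally `z - T = (1 - (μ - z)R)(μ - T)`, and the first factor is invertible for
`z` near `μ`. -/
theorem IsClosedRel.isOpen_resolventSet [CompleteSpace X] (hT : T.IsClosedRel) :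
    IsOpen T.resolventSet := by
  rw [isOpen_iff_mem_nhds]
  rintro μ ⟨R, hR⟩
  have hmem : ∀ x w, (x, w) ∈ T ↔ R (μ • x - w) = x := fun x w => by
    have h := mem_resolventAt_iff (T := T) (z := μ) (x := x) (w := μ • x - w)
    rw [sub_sub_cancel, hR, LinearMap.mem_graph_iff] at h
    exact h.symm.trans eq_comm
  have hU : ∀ᶠ z in 𝓝 μ, IsUnit (1 - (μ - z) • R) := by
    have : Tendsto (fun z => 1 - (μ - z) • R) (𝓝 μ) (𝓝 (1 - (μ - μ) • R)) :=
      Continuous.tendsto (by fun_prop) μ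
    exact this.eventually (Units.isOpen.mem_nhds (by simp))
  filter_upwards [hU] with z hz
  obtain ⟨hinj, hsurj⟩ := ContinuousLinearMap.isUnit_iff_bijective.1 hz
  rw [mem_resolventSet_iff hT]
  constructor
  · rw [Submodule.eq_bot_iff]
    intro x hx
    rw [mem_nullSpace, mem_scalarSub_iff, hmem] at hx
    refine hinj ?_
    rw [map_zero, sub_apply, sub_eq_zero]
    simpa [← sub_smul, eq_comm] using hx
  · rw [eq_top_iff]
    intro y _
    obtain ⟨u, hu⟩ := hsurj y
    rw [mem_range]
    refine ⟨R u, ?_⟩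
    rw [mem_scalarSub_iff, hmem, ← hu]
    congr 1
    simp
    module

theorem resolventSet_subset_essResolvent4 [CompleteSpace X] (hT : T.IsClosedRel) :
    T.resolventSet ⊆ T.essResolvent4 := by
  intro z hz
  obtain ⟨hN, hR⟩ := (mem_resolventSet_iff hT).1 hz
  have hα : (scalarSub z T).nullity = 0 := by simp [nullity, hN]
  have hβ : (scalarSub z T).deficiency = 0 := by
    have : Subsingleton (X ⧸ (scalarSub z T).range) :=
      Submodule.Quotient.subsingleton_iff.2 hR
    simp [deficiency]
  refine ⟨⟨hT.scalarSub z, ?_, ?_, ?_⟩, ?_⟩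
  · rw [hR]
    exact isClosed_univ
  · simp [hα]
  · simp [hβ]
  · simp [index, hα, hβ]

theorem essResolvent4_subset_essResolvent3 : T.essResolvent4 ⊆ T.essResolvent3 :=
  fun _ h => h.1

theorem essResolvent3_subset_essResolvent2 : T.essResolvent3 ⊆ T.essResolvent2 :=
  fun _ h => ⟨h.1, h.2.1, h.2.2.1⟩

theorem essResolvent2_subset_essResolvent1 : T.essResolvent2 ⊆ T.essResolvent1 :=
  fun _ h => Or.inl h

theorem resolventSet_subset_essResolvent1 [CompleteSpace X] (hT : T.IsClosedRel) :
    T.resolventSet ⊆ T.essResolvent1 :=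
  (resolventSet_subset_essResolvent4 hT).trans <| essResolvent4_subset_essResolvent3.trans <|
    essResolvent3_subset_essResolvent2.trans essResolvent2_subset_essResolvent1

/-- Arbitrary connected sets, unlike components, can be shrunk and mapped forward freely. -/
theorem mem_essResolvent5_iff {z : ℂ} :
    z ∈ T.essResolvent5 ↔
      ∃ C ⊆ T.essResolvent1, IsPreconnected C ∧ z ∈ C ∧ (C ∩ T.resolventSet).Nonempty := by
  constructor
  · rintro ⟨_, ⟨⟨w, -, rfl⟩, hρ⟩, hz⟩
    exact ⟨_, connectedComponentIn_subset _ _, isPreconnected_connectedComponentIn, hz, hρ⟩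
  · rintro ⟨C, hCS, hC, hz, hρ⟩
    have hsub := hC.subset_connectedComponentIn hz hCS
    exact ⟨_, ⟨⟨z, hCS hz, rfl⟩, hρ.mono (Set.inter_subset_inter_left _ hsub)⟩, hsub hz⟩

theorem resolventSet_subset_essResolvent5 [CompleteSpace X] (hT : T.IsClosedRel) :
    T.resolventSet ⊆ T.essResolvent5 := fun z hz =>
  mem_essResolvent5_iff.2 ⟨{z}, by simpa using resolventSet_subset_essResolvent1 hT hz,
    isPreconnected_singleton, rfl, z, rfl, hz⟩

theorem resolventSet_subset_essResolvent [CompleteSpace X] (hT : T.IsClosedRel) (i : Fin 5) :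
    T.resolventSet ⊆ T.essResolvent i := by
  have h4 := resolventSet_subset_essResolvent4 hT
  have h3 := h4.trans essResolvent4_subset_essResolvent3
  fin_cases i
  · exact resolventSet_subset_essResolvent1 hT
  · exact h3.trans essResolvent3_subset_essResolvent2
  · exact h3
  · exact h4
  · exact resolventSet_subset_essResolvent5 hT

theorem scalarSub_graph (A : X →L[ℂ] X) (z : ℂ) :
    scalarSub z (LinearMap.graph (A : X →ₗ[ℂ] X)) =
      LinearMap.graph ((z • 1 - A : X →L[ℂ] X) : X →ₗ[ℂ] X) := by
  ext ⟨x, w⟩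
  rw [mem_scalarSub_iff, LinearMap.mem_graph_iff, LinearMap.mem_graph_iff]
  simp [sub_eq_iff_eq_add, eq_sub_iff_add_eq, eq_comm, add_comm]

/-- Finite codimension already forces closed range, so each of the two alternatives is stable under
small perturbations. -/
theorem isOpen_essResolvent1_graph [CompleteSpace X] (A : X →L[ℂ] X) :
    IsOpen (essResolvent1 (LinearMap.graph (A : X →ₗ[ℂ] X))) := by
  have hmem : ∀ z, z ∈ essResolvent1 (LinearMap.graph (A : X →ₗ[ℂ] X)) ↔
      IsClosed ((z • 1 - A : X →L[ℂ] X).range : Set X) ∧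
          FiniteDimensional ℂ (z • 1 - A : X →L[ℂ] X).ker ∨
        FiniteDimensional ℂ (X ⧸ (z • 1 - A : X →L[ℂ] X).range) := fun z => by
    have hcl : FiniteDimensional ℂ (X ⧸ (z • 1 - A : X →L[ℂ] X).range) →
        IsClosed ((z • 1 - A : X →L[ℂ] X).range : Set X) := fun _ =>
      (z • 1 - A : X →L[ℂ] X).isClosed_range_of_finiteDimensional_quotient_range
    change IsUpperSemiFredholm _ ∨ IsLowerSemiFredholm _ ↔ _
    rw [scalarSub_graph, IsUpperSemiFredholm, IsLowerSemiFredholm, nullity_lt_top_iff,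
      deficiency_lt_top_iff, nullSpace_graph, range_graph]
    have := isClosedRel_graph (z • 1 - A)
    tauto
  have hcont : Continuous fun z : ℂ => z • 1 - A := by fun_prop
  rw [isOpen_iff_mem_nhds]
  intro z hz
  rcases (hmem z).1 hz with ⟨hcl, hfd⟩ | hfd
  · filter_upwards [hcont.continuousAt.eventually
      ((z • 1 - A).eventually_isClosed_range_and_finiteDimensional_ker hcl)] with w hw
    exact (hmem w).2 (Or.inl hw)
  · filter_upwards [hcont.continuousAt.eventually
      (z • 1 - A).eventually_finiteDimensional_quotient_range] with w hw
    exact (hmem w).2 (Or.inr hw)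

/-! ### Transfer between the relation and its resolvent -/

section Resolvent

variable {μ z : ℂ}

theorem mem_resolventSet_resolventAt_iff [CompleteSpace X] (hT : T.IsClosedRel) (hz : z ≠ μ) :
    (μ - z)⁻¹ ∈ (T.resolventAt μ).resolventSet ↔ z ∈ T.resolventSet := by
  rw [mem_resolventSet_iff hT, mem_resolventSet_iff (hT.resolventAt μ),
    nullSpace_scalarSub_resolventAt T hz, range_scalarSub_resolventAt T hz]

variable (T) in
theorem nullity_scalarSub_resolventAt (hz : z ≠ μ) :
    (scalarSub (μ - z)⁻¹ (T.resolventAt μ)).nullity = (scalarSub z T).nullity := by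
  rw [nullity, nullSpace_scalarSub_resolventAt T hz, nullity]

variable (T) in
theorem deficiency_scalarSub_resolventAt (hz : z ≠ μ) :
    (scalarSub (μ - z)⁻¹ (T.resolventAt μ)).deficiency = (scalarSub z T).deficiency := by
  rw [deficiency, range_scalarSub_resolventAt T hz, deficiency]

theorem isUpperSemiFredholm_scalarSub_resolventAt_iff (hT : T.IsClosedRel) (hz : z ≠ μ) :
    (scalarSub (μ - z)⁻¹ (T.resolventAt μ)).IsUpperSemiFredholm ↔
      (scalarSub z T).IsUpperSemiFredholm := by
  simp only [IsUpperSemiFredholm, nullity_scalarSub_resolventAt T hz,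
    range_scalarSub_resolventAt T hz, hT.scalarSub z, (hT.resolventAt μ).scalarSub _]

theorem isLowerSemiFredholm_scalarSub_resolventAt_iff (hT : T.IsClosedRel) (hz : z ≠ μ) :
    (scalarSub (μ - z)⁻¹ (T.resolventAt μ)).IsLowerSemiFredholm ↔
      (scalarSub z T).IsLowerSemiFredholm := by
  simp only [IsLowerSemiFredholm, deficiency_scalarSub_resolventAt T hz,
    range_scalarSub_resolventAt T hz, hT.scalarSub z, (hT.resolventAt μ).scalarSub _]

theorem isFredholm_scalarSub_resolventAt_iff (hT : T.IsClosedRel) (hz : z ≠ μ) :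
    (scalarSub (μ - z)⁻¹ (T.resolventAt μ)).IsFredholm ↔ (scalarSub z T).IsFredholm := by
  simp only [IsFredholm, nullity_scalarSub_resolventAt T hz, deficiency_scalarSub_resolventAt T hz,
    range_scalarSub_resolventAt T hz, hT.scalarSub z, (hT.resolventAt μ).scalarSub _]

variable (T) in
theorem index_scalarSub_resolventAt (hz : z ≠ μ) :
    (scalarSub (μ - z)⁻¹ (T.resolventAt μ)).index = (scalarSub z T).index := by
  rw [index, index, nullity_scalarSub_resolventAt T hz, deficiency_scalarSub_resolventAt T hz]

theorem mem_essResolvent1_resolventAt_iff (hT : T.IsClosedRel) (hz : z ≠ μ) :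
    (μ - z)⁻¹ ∈ (T.resolventAt μ).essResolvent1 ↔ z ∈ T.essResolvent1 :=
  or_congr (isUpperSemiFredholm_scalarSub_resolventAt_iff hT hz)
    (isLowerSemiFredholm_scalarSub_resolventAt_iff hT hz)

theorem mem_essResolvent5_resolventAt_iff [CompleteSpace X] (hT : T.IsClosedRel)
    (hμ : μ ∈ T.resolventSet) (hz : z ≠ μ) : (μ - z)⁻¹ ∈ (T.resolventAt μ).essResolvent5 ↔ z ∈ T.essResolvent5 := by
  rw [mem_essResolvent5_iff, mem_essResolvent5_iff]
  constructor
  · rintro ⟨C, hCS, hC, hzC, hCρ⟩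
    have hopen : IsOpen (T.resolventAt μ).essResolvent1 := by
      obtain ⟨R, hR⟩ := hμ
      exact hR ▸ isOpen_essResolvent1_graph R
    -- The connecting set must avoid `0`, where the inverse map `w ↦ μ - w⁻¹` is not continuous.
    obtain ⟨D, hDS, hD, hzD, h0, q, hqD, hqρ⟩ := hC.exists_notMem hCS hopen.mem_nhds
      (hT.resolventAt μ).isOpen_resolventSet hzC (inv_ne_zero (sub_ne_zero.2 hz.symm)) hCρ
    have hne : ∀ w ∈ D, w ≠ 0 := fun w hw h => h0 (h ▸ hw)
    have hinv : ∀ w : ℂ, (μ - (μ - w⁻¹))⁻¹ = w := fun w => by simp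
    have hneμ : ∀ w ∈ D, μ - w⁻¹ ≠ μ := fun w hw => by simpa using hne w hw
    refine ⟨(fun w => μ - w⁻¹) '' D, ?_, ?_, ⟨_, hzD, by simp⟩, _, ⟨q, hqD, rfl⟩, ?_⟩
    · rintro _ ⟨w, hw, rfl⟩
      rw [← mem_essResolvent1_resolventAt_iff hT (hneμ w hw), hinv]
      exact hDS hw
    · exact hD.image _ (continuousOn_const.sub (continuousOn_id.inv₀ hne))
    · rwa [← mem_resolventSet_resolventAt_iff hT (hneμ q hqD), hinv]
  · rintro ⟨C, hCS, hC, hzC, hCρ⟩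
    have hnhds : T.essResolvent1 ∈ 𝓝 μ :=
      mem_of_superset (hT.isOpen_resolventSet.mem_nhds hμ) (resolventSet_subset_essResolvent1 hT)
    obtain ⟨D, hDS, hD, hzD, hμD, q, hqD, hqρ⟩ := hC.exists_notMem hCS (fun _ => hnhds)
      hT.isOpen_resolventSet hzC hz hCρ
    have hne : ∀ w ∈ D, w ≠ μ := fun w hw h => hμD (h ▸ hw)
    refine ⟨(fun w => (μ - w)⁻¹) '' D, ?_, ?_, ⟨z, hzD, rfl⟩, _, ⟨q, hqD, rfl⟩, ?_⟩
    · rintro _ ⟨w, hw, rfl⟩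
      exact (mem_essResolvent1_resolventAt_iff hT (hne w hw)).2 (hDS hw)
    · exact hD.image _ ((continuousOn_const.sub continuousOn_id).inv₀
        fun w hw => sub_ne_zero.2 (hne w hw).symm)
    · exact (mem_resolventSet_resolventAt_iff hT (hne q hqD)).2 hqρ

theorem mem_essResolvent_resolventAt_iff [CompleteSpace X] (hT : T.IsClosedRel)
    (hμ : μ ∈ T.resolventSet) (hz : z ≠ μ) (i : Fin 5) :
    (μ - z)⁻¹ ∈ (T.resolventAt μ).essResolvent i ↔ z ∈ T.essResolvent i := by
  fin_cases i
  · exact mem_essResolvent1_resolventAt_iff hT hz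
  · exact isUpperSemiFredholm_scalarSub_resolventAt_iff hT hz
  · exact isFredholm_scalarSub_resolventAt_iff hT hz
  · exact and_congr (isFredholm_scalarSub_resolventAt_iff hT hz)
      (by rw [index_scalarSub_resolventAt T hz])
  · exact mem_essResolvent5_resolventAt_iff hT hμ hz

end Resolvent

end Spectrum

end LinearRelation

theorem mainTheorem2 {X : Type*} [NormedAddCommGroup X] [NormedSpace ℂ X] [CompleteSpace X]
    (T : LinearRelation X X) (hT : T.IsClosedRel) (μ : ℂ) (hμ : μ ∈ T.resolventSet)
    (i : Fin 5) (z : ℂ) :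
    z ∈ T.essSpectrum i ↔ z ≠ μ ∧ (μ - z)⁻¹ ∈ (T.resolventAt μ).essSpectrum i := by
  have hμi := LinearRelation.resolventSet_subset_essResolvent hT i hμ
  by_cases hz : z = μ
  · subst hz
    exact iff_of_false (not_not_intro hμi) fun h => h.1 rfl
  · exact ((not_congr (LinearRelation.mem_essResolvent_resolventAt_iff hT hμ hz i)).symm).trans
      (and_iff_right hz).symm
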